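/- Fix $n,m\ge 0$. A *parametric model* on latent space $\mathbb R^n$ consists of a time lag $L\ge 0$, matrices $B_1,\dots,B_L\in\mathbb R^{n\times n}$, parameters $\alpha_i\in(0,2)$ and $\lambda_i>0$ ($1\le i\le n$), and a Borel mixing function $g:\mathbb R^n\to\mathbb R^m$ that is injective and differentiable Lebesgue-almost everywhere. It generates observations $x_t=g(z_t)$, $t=0,1,2,\dots$, from latent vectors $z_t\in\mathbb R^n$ with $$z_t=\sum_{\tau=1}^{L}B_\tau z_{t-\tau}+\varepsilon_t\qquad(t\ge L),$$ where the noises $\varepsilon_{it}$ ($1\le i\le n$, $t\ge L$) are mutually independent (over $i$ and $t$), the law of $\varepsilon_{it}$ does not depend on $t$ and is the generalized Laplacian distribution with density $$p_{\varepsilon_i}(x)=\frac{\alpha_i\lambda_i^{1/\alpha_i}}{2\,\Gamma(1/\alpha_i)}\exp\bigl(-\lambda_i|x|^{\alpha_i}\bigr),$$ and the initial block $(z_0,\dots,z_{L-1})$ has an arbitrary law and is independent of the noises. Two parametric models (with the same $n,m$) are *observationally equivalent* if their observed sequences $(x_t)_{t\ge 0}$ have the same joint distribution. **Theorem.** Let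 a (true) parametric model with mixing function $g$ be given in which at least one of the matrices $B_\tau$ has full rank $n$. Then its latent process is identifiable up to permutation and componentwise invertible transformations: for every (learned) parametric model, with mixing function $\hat g$ and its own lag, transition matrices, noise parameters and initial law, that is observationally equivalent to the true one, there are a permutation $\pi$ of $\{1,\dots,n\}$ and homeomorphisms $T_1,\dots,T_n:\mathbb R\to\mathbb R$ such that $$\hat g(z)=g\bigl(T_1(z_{\pi(1)}),\dots,T_n(z_{\pi(n)})\bigr)\qquad\text{for Lebesgue-almost every } z\in\mathbb R^n,$$ and this equation holds for every $z\in\mathbb R^n$ if $g$ and $\hat g$ are continuous. -/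

import Mathlib

open MeasureTheory ProbabilityTheory

/-- The density `α λ^(1/α) / (2 Γ(1/α)) · exp (-λ |x|^α)` of the generalized Laplacian
distribution with shape `α > 0` and parameter `lam = λ > 0`. -/
noncomputable def genLaplacePDF (α lam x : ℝ) : ℝ :=
  α * lam ^ (1 / α) / (2 * Real.Gamma (1 / α)) * Real.exp (-lam * |x| ^ α)

/-- The generalized Laplacian distribution on the real line. -/
noncomputable def genLaplace (α lam : ℝ) : Measure ℝ :=
  volume.withDensity fun x => ENNReal.ofReal (genLaplacePDF α lam x)

/-- `z 0, z 1, z 2, …` is, under the probability measure `P`, a latent vector autoregressive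
process of order `L` in dimension `n`, with transition matrix `B τ` at lag `τ + 1`, driven by the
noises `ε t` for `t ≥ L`. The noise components are spatially and temporally independent,
stationary and generalized Laplacian with shapes `α i` in `(0, 2)`.
The first `L` latent vectors are initial values of arbitrary law, independent of the noises. -/
structure IsGenLaplaceVAR {Ω : Type*} [MeasurableSpace Ω] (P : Measure Ω) {n L : ℕ}
    (B : Fin L → Matrix (Fin n) (Fin n) ℝ) (α lam : Fin n → ℝ)
    (z ε : ℕ → Ω → Fin n → ℝ) : Prop where
  shape_pos : ∀ i, 0 < α i
  shape_lt_two : ∀ i, α i < 2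
  lam_pos : ∀ i, 0 < lam i
  measurable_latent : ∀ t, Measurable (z t)
  measurable_noise : ∀ t, L ≤ t → Measurable (ε t)
  transition : ∀ t, L ≤ t → ∀ᵐ ω ∂P,
    z t ω = ∑ τ : Fin L, (B τ).mulVec (z (t - (τ + 1)) ω) + ε t ω
  noise_law : ∀ t, L ≤ t → ∀ i, P.map (fun ω => ε t ω i) = genLaplace (α i) (lam i)
  noise_indep : iIndepFun (fun (p : {t : ℕ // L ≤ t} × Fin n) ω => ε p.1 ω p.2) P
  initial_indep : IndepFun (fun ω (s : Fin L) => z s ω)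
    (fun ω (s : {t : ℕ // L ≤ t}) => ε s ω) P

/-- Mixing functions: injective and (Lebesgue-)almost everywhere differentiable maps; Borel
measurability makes the observations random variables. -/
structure IsMixing {n m : ℕ} (g : (Fin n → ℝ) → (Fin m → ℝ)) : Prop where
  measurable : Measurable g
  injective : Function.Injective g
  ae_differentiable : ∀ᵐ z, DifferentiableAt ℝ g z

/-- Two generative models are observationally equivalent: the observed sequences
`x t = g (z t)` and `x' t = g' (z' t)`, `t = 0, 1, 2, …`, have the same joint distribution. -/
def ObservationallyEquivalent {Ω Ω' : Type*} [MeasurableSpace Ω] [MeasurableSpace Ω'] {n m : ℕ}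
    (P : Measure Ω) (g : (Fin n → ℝ) → (Fin m → ℝ)) (z : ℕ → Ω → Fin n → ℝ)
    (P' : Measure Ω') (g' : (Fin n → ℝ) → (Fin m → ℝ)) (z' : ℕ → Ω' → Fin n → ℝ) : Prop :=
  P'.map (fun ω (t : ℕ) => g' (z' t ω)) = P.map (fun ω (t : ℕ) => g (z t ω))

/-- `g' = g ∘ T ∘ π` for a permutation `π` of the coordinates and a componentwise invertible
transformation `T`. Since laws determine the mixing functions only up to Lebesgue-null sets, the
equation is required almost everywhere, and everywhere if both mixing functions are continuous. -/
def EqUpToPermComponentwise {n m : ℕ} (g g' : (Fin n → ℝ) → (Fin m → ℝ)) : Prop :=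
  ∃ (π : Equiv.Perm (Fin n)) (T : Fin n → (ℝ ≃ₜ ℝ)),
    (∀ᵐ z : Fin n → ℝ, g' z = g (fun i => T i (z (π i)))) ∧
    (Continuous g → Continuous g' → ∀ z : Fin n → ℝ, g' z = g (fun i => T i (z (π i))))

/-!
The proof compares the two models through the conditional law of one observation given all the
previous ones.

Write `F` and `F'` for the potentials `∑ i, lam i * |x i| ^ α i` of the true and of the learned
noise, whose joint densities are proportional to `exp (-F)` and `exp (-F')`. Given the past, the
next true latent vector has density proportional to `exp (-F (x - a))`, where `a` is the drift
computed from the past; likewise with `F'` and `b` for the learned model. Mixing functions are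
measurable embeddings, so the past latent vectors can be recovered from the past observations, and
uniqueness of conditional laws gives pairs `(a, b)` that match: the law of `a + noise` pushed by
`g` is the law of `b + noise'` pushed by `g'`. A transition matrix of full rank makes the drift
charge every open set, so the matched `a` are dense
(`dense_matches_of_observationallyEquivalent`).

Location families with a continuous density are setwise continuous, and tightness keeps the matched
`b` bounded, so matching is a closed proper relation; it is the graph of a continuous injective map
`k : ℝⁿ → ℝⁿ` (`exists_continuous_matching`). Let `h` be the change of latent variables
`g⁻¹ ∘ g'`. In quotients of densities of two matched laws the Jacobian of `h` and all constants
cancel, and for almost every `w` and all `a`, `a'`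
  `F (h w - a) - F (h w - a') = F' (w - k a) - F' (w - k a')`   (`Matches.ae_sub_eq_sub`).

If `a` and `a'` differ in the `j`-th coordinate only, the left-hand side ignores their common
coordinates. Splitting the right-hand side into functions of the single `w i`, and using that
`|x| ^ α` with `α < 2` is singular at the origin only (`eq_or_eq_of_rpow_abs_sub_eq_const`), one
finds that each coordinate of `k` depends on at most one variable (`apply_update_eq_or_eq`). Being
injective and proper, `k` is then a permutation composed with homeomorphisms of the coordinates.
Finally, `a = h w` and `a' = k⁻¹ w` give `-F (h w - k⁻¹ w) = F' (w - k (h w)) ≥ 0`, whence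
`h w = k⁻¹ w`. The argument never differentiates a mixing function.
-/

open Filter Topology Set Function

/-! ### Singularities of powers of the absolute value -/

/-- The symmetric second difference of `x ↦ |x - q| ^ α` at `p` is of exact order `t ^ α` at the
singularity `p = q`, and `O(t ^ 2)`, hence negligible against `t ^ α`, elsewhere. -/
theorem tendsto_secondDifference_rpow_abs {α : ℝ} (h0 : 0 < α) (h2 : α < 2) (p q : ℝ) :
    Tendsto (fun t : ℝ => (|p + t - q| ^ α + |p - t - q| ^ α - 2 * |p - q| ^ α) / t ^ α)
      (𝓝[>] 0) (𝓝 (if q = p then 2 else 0)) := by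
  split_ifs with hqp
  · subst hqp
    refine tendsto_const_nhds.congr' ?_
    filter_upwards [self_mem_nhdsWithin] with t ht
    have ht' : (0 : ℝ) < t := ht
    have h1 : q + t - q = t := by ring
    have h3 : q - t - q = -t := by ring
    rw [h1, h3, abs_neg, abs_of_pos ht', sub_self, abs_zero, Real.zero_rpow h0.ne']
    field_simp
    ring
  · have hpq : 0 < |p - q| := abs_pos.2 (sub_ne_zero.2 (Ne.symm hqp))
    set δ := |p - q| / 2 with hδ
    have hδ0 : 0 < δ := by positivity
    set s : Set ℝ := Icc (p - δ) (p + δ)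
    set u : ℝ → ℝ := fun x => |x - q| ^ α
    have hs : s ∈ 𝓝 p := Icc_mem_nhds (by linarith) (by linarith)
    have hps : p ∈ s := mem_of_mem_nhds hs
    have hu : ContDiffOn ℝ 2 u s := by
      intro x hx
      have hxq : x - q ≠ 0 := by
        intro h
        have hx' : |x - p| ≤ δ := abs_le.2 ⟨by linarith [hx.1], by linarith [hx.2]⟩
        have : x = q := by linarith
        rw [this, abs_sub_comm] at hx'
        linarith
      have h1 : ContDiffAt ℝ 2 (fun x => |x - q|) x :=
        (contDiffAt_abs hxq).comp x (contDiffAt_id.sub contDiffAt_const)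
      exact (h1.rpow_const_of_ne (abs_ne_zero.2 hxq)).contDiffWithinAt
    -- The second-order Taylor expansion at `p`, read at `p + t` and at `p - t`.
    have hT := taylor_isLittleO (convex_Icc _ _) hps (n := 2) hu
    rw [nhdsWithin_eq_nhds.2 hs] at hT
    set c := iteratedDerivWithin 2 u s p
    have hplus : Tendsto (fun t : ℝ => p + t) (𝓝[>] 0) (𝓝 p) := by
      have : Tendsto (fun t : ℝ => p + t) (𝓝 0) (𝓝 (p + 0)) :=
        tendsto_const_nhds.add tendsto_id
      rw [add_zero] at this
      exact this.mono_left nhdsWithin_le_nhds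
    have hminus : Tendsto (fun t : ℝ => p - t) (𝓝[>] 0) (𝓝 p) := by
      have : Tendsto (fun t : ℝ => p - t) (𝓝 0) (𝓝 (p - 0)) :=
        tendsto_const_nhds.sub tendsto_id
      rw [sub_zero] at this
      exact this.mono_left nhdsWithin_le_nhds
    have e1 := hT.comp_tendsto hplus
    have e2 := hT.comp_tendsto hminus
    have e2' : ((fun x => u x - taylorWithinEval u 2 s p x) ∘ fun t => p - t)
        =o[𝓝[>] 0] ((fun x => (x - p) ^ 2) ∘ fun t => p + t) := by
      refine e2.congr_right fun t => ?_
      simp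
    have e3 := (e1.add e2').tendsto_div_nhds_zero
    have hpow : Tendsto (fun t : ℝ => t ^ (2 - α)) (𝓝[>] 0) (𝓝 0) := by
      have := (Real.continuousAt_rpow_const 0 (2 - α) (Or.inr (by linarith))).tendsto
      rw [Real.zero_rpow (by linarith)] at this
      exact this.mono_left nhdsWithin_le_nhds
    have e4 := (e3.add_const c).mul hpow
    rw [mul_zero] at e4
    refine e4.congr' ?_
    filter_upwards [self_mem_nhdsWithin] with t ht
    have ht' : (0 : ℝ) < t := ht
    rw [Real.rpow_sub ht', Real.rpow_two]
    simp only [comp_apply, taylorWithinEval_succ, taylor_within_zero_eval, add_sub_cancel_left,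
      Nat.factorial, smul_eq_mul]
    have h3 : t ^ α ≠ 0 := (Real.rpow_pos_of_pos ht' α).ne'
    field_simp
    simp only [u, c]
    push_cast
    ring

/-- The functions `x ↦ |x - q| ^ α` with `0 < α < 2` have a singularity at `q` and nowhere else,
so a linear combination of them that is constant has zero total weight at every point. -/
theorem sum_weight_eq_zero_of_sum_rpow_abs_eq_const {ι : Type*} [Fintype ι] {α : ℝ} (h0 : 0 < α)
    (h2 : α < 2) (c q : ι → ℝ) (C : ℝ) (h : ∀ x, ∑ i, c i * |x - q i| ^ α = C) (p : ℝ) :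
    ∑ i, c i * (if q i = p then 1 else 0) = 0 := by
  have h1 : Tendsto (fun t : ℝ => ∑ i, c i *
      ((|p + t - q i| ^ α + |p - t - q i| ^ α - 2 * |p - q i| ^ α) / t ^ α))
      (𝓝[>] 0) (𝓝 (∑ i, c i * (if q i = p then 2 else 0))) :=
    tendsto_finsetSum _ fun i _ => (tendsto_secondDifference_rpow_abs h0 h2 p (q i)).const_mul _
  have h3 : (fun t : ℝ => ∑ i, c i *
      ((|p + t - q i| ^ α + |p - t - q i| ^ α - 2 * |p - q i| ^ α) / t ^ α)) = fun _ => 0 := by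
    funext t
    have : ∑ i, c i * ((|p + t - q i| ^ α + |p - t - q i| ^ α - 2 * |p - q i| ^ α) / t ^ α)
        = ((∑ i, c i * |p + t - q i| ^ α) + (∑ i, c i * |p - t - q i| ^ α)
          - 2 * ∑ i, c i * |p - q i| ^ α) / t ^ α := by
      rw [Finset.mul_sum, ← Finset.sum_add_distrib, ← Finset.sum_sub_distrib, Finset.sum_div]
      exact Finset.sum_congr rfl fun i _ => by ring
    rw [this, h, h, h]
    ring
  rw [h3] at h1
  have h4 := tendsto_nhds_unique h1 tendsto_const_nhds
  have h5 : ∑ i, c i * (if q i = p then (2 : ℝ) else 0)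
      = 2 * ∑ i, c i * (if q i = p then 1 else 0) := by
    rw [Finset.mul_sum]
    exact Finset.sum_congr rfl fun i _ => by split_ifs <;> ring
  linarith

/-- Up to additive constants, a difference `|x - b| ^ α - |x - b'| ^ α` determines `b` and `b'`,
unless it vanishes. -/
theorem eq_or_eq_of_rpow_abs_sub_eq_const {α : ℝ} (h0 : 0 < α) (h2 : α < 2) {b b' c c' C : ℝ}
    (h : ∀ x : ℝ, |x - b| ^ α - |x - b'| ^ α - (|x - c| ^ α - |x - c'| ^ α) = C) :
    (b = b' ∧ c = c') ∨ (b = c ∧ b' = c') := by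
  have key : ∀ p, (if b = p then (1 : ℝ) else 0) - (if b' = p then 1 else 0)
      - (if c = p then 1 else 0) + (if c' = p then 1 else 0) = 0 := fun p => by
    have := sum_weight_eq_zero_of_sum_rpow_abs_eq_const h0 h2 ![1, -1, -1, 1] ![b, b', c, c'] C
      (fun x => by simp [Fin.sum_univ_four]; linarith [h x]) p
    refine Eq.trans ?_ this
    rw [Fin.sum_univ_four]
    simp only [Matrix.cons_val]
    ring_nf
    rfl
  have kb := key b
  have kb' := key b'
  have kc := key c
  clear key h
  grind

theorem eq_of_sum_comp_apply_eq {ι : Type*} [Fintype ι] [DecidableEq ι] {ψ : ι → ℝ → ℝ} {C : ℝ}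
    (h : ∀ w : ι → ℝ, ∑ i, ψ i (w i) = C) (i : ι) (x y : ℝ) : ψ i x = ψ i y := by
  have hx := h (update (0 : ι → ℝ) i x)
  have hy := h (update (0 : ι → ℝ) i y)
  rw [← Finset.add_sum_erase _ _ (Finset.mem_univ i)] at hx hy
  have : ∑ j ∈ Finset.univ.erase i, ψ j (update (0 : ι → ℝ) i x j)
      = ∑ j ∈ Finset.univ.erase i, ψ j (update (0 : ι → ℝ) i y j) :=
    Finset.sum_congr rfl fun j hj => by
      rw [update_of_ne (Finset.ne_of_mem_erase hj), update_of_ne (Finset.ne_of_mem_erase hj)]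
  simp only [update_self] at hx hy
  linarith

/-! ### Potentials and coordinatewise dependence -/

/-- The separable function `∑ i, lam i * |x i| ^ α i`: minus the logarithm of the joint density of
independent generalized Laplacian noises, up to an additive constant. -/
noncomputable def potential {ι : Type*} [Fintype ι] (α lam x : ι → ℝ) : ℝ :=
  ∑ i, lam i * |x i| ^ α i

section Potential

variable {ι : Type*} [Fintype ι] {α lam : ι → ℝ}

theorem continuous_potential (h0 : ∀ i, 0 < α i) : Continuous (potential α lam) := by
  unfold potential
  exact continuous_finsetSum _ fun i _ =>
    (((continuous_apply i).abs).rpow_const fun _ => Or.inr (h0 i).le).const_mul _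

theorem potential_zero (h0 : ∀ i, 0 < α i) : potential α lam 0 = 0 := by
  simp [potential, Real.zero_rpow (h0 _).ne']

theorem potential_nonneg (hl : ∀ i, 0 < lam i) (x : ι → ℝ) : 0 ≤ potential α lam x :=
  Finset.sum_nonneg fun i _ => mul_nonneg (hl i).le (Real.rpow_nonneg (abs_nonneg _) _)

theorem eq_zero_of_potential_nonpos (h0 : ∀ i, 0 < α i) (hl : ∀ i, 0 < lam i) {x : ι → ℝ}
    (h : potential α lam x ≤ 0) : x = 0 := by
  have h1 := le_antisymm h (potential_nonneg hl x)
  unfold potential at h1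
  rw [Finset.sum_eq_zero_iff_of_nonneg fun i _ =>
    mul_nonneg (hl i).le (Real.rpow_nonneg (abs_nonneg _) _)] at h1
  funext i
  have h2 := (mul_eq_zero.1 (h1 i (Finset.mem_univ i))).resolve_left (hl i).ne'
  exact abs_eq_zero.1 ((Real.rpow_eq_zero (abs_nonneg _) (h0 i).ne').1 h2)

theorem potential_sub_update_sub [DecidableEq ι] (y a : ι → ℝ) (j : ι) (s s' : ℝ) :
    potential α lam (y - update a j s) - potential α lam (y - update a j s')
      = lam j * |y j - s| ^ α j - lam j * |y j - s'| ^ α j := by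
  unfold potential
  rw [← Finset.sum_sub_distrib, Finset.sum_eq_single j]
  · simp
  · intro i _ hij
    simp [update_of_ne hij]
  · simp

end Potential

section Coordinates

variable {ι : Type*} [Fintype ι] [DecidableEq ι]

/-- If the effect on `x ↦ potential (x - k a)` of changing the `j`-th coordinate of `a` does not
depend on the other coordinates of `a`, then for each `i` either that change leaves `k a i` fixed
or the other coordinates do not matter for `k a i`. -/
theorem apply_update_eq_or_eq {α lam : ι → ℝ} (h0 : ∀ i, 0 < α i) (h2 : ∀ i, α i < 2)
    (hl : ∀ i, 0 < lam i) {k : (ι → ℝ) → ι → ℝ} {j : ι} {a c : ι → ℝ} {s s' : ℝ}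
    (h : ∀ w, potential α lam (w - k (update a j s)) - potential α lam (w - k (update a j s'))
      = potential α lam (w - k (update c j s)) - potential α lam (w - k (update c j s'))) (i : ι) :
    (k (update a j s) i = k (update a j s') i ∧ k (update c j s) i = k (update c j s') i) ∨
    (k (update a j s) i = k (update c j s) i ∧ k (update a j s') i = k (update c j s') i) := by
  set ψ : ι → ℝ → ℝ := fun i x => lam i * (|x - k (update a j s) i| ^ α i
    - |x - k (update a j s') i| ^ α i - (|x - k (update c j s) i| ^ α i
      - |x - k (update c j s') i| ^ α i)) with hψ
  have hsum : ∀ w : ι → ℝ, ∑ i, ψ i (w i) = 0 := fun w => by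
    have := h w
    simp only [potential, Pi.sub_apply] at this
    simp only [hψ, mul_sub, Finset.sum_sub_distrib]
    linarith
  refine eq_or_eq_of_rpow_abs_sub_eq_const (h0 i) (h2 i) (C := ψ i 0 / lam i) fun x => ?_
  rw [eq_div_iff (hl i).ne', ← eq_of_sum_comp_apply_eq hsum i x 0, mul_comm]

/-- An injective map, each coordinate of which depends on at most one variable, is a
componentwise map followed by a permutation of the coordinates. -/
theorem exists_perm_of_apply_update_eq_or_eq {k : (ι → ℝ) → ι → ℝ} (hk : Injective k)
    (h : ∀ (i j : ι) (a c : ι → ℝ) (s s' : ℝ),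
      (k (update a j s) i = k (update a j s') i ∧ k (update c j s) i = k (update c j s') i) ∨
      (k (update a j s) i = k (update c j s) i ∧ k (update a j s') i = k (update c j s') i)) :
    ∃ τ : Equiv.Perm ι, ∀ j x y, x j = y j → k x (τ j) = k y (τ j) := by
  have hdep : ∀ i j a s s', k (update a j s) i ≠ k (update a j s') i →
      ∀ x y, x j = y j → k x i = k y i := by
    intro i j a s s' hne
    have main : ∀ x : ι → ℝ, k x i = k (update a j (x j)) i := by
      intro x
      -- `k` takes at `update a j (x j)` another `i`-th coordinate than at one of `update a j s`,
      -- `update a j s'`, so the second alternative of `h` applies to that pair.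
      by_cases hs : k (update a j (x j)) i = k (update a j s) i
      · have hs' : k (update a j (x j)) i ≠ k (update a j s') i := hs ▸ hne
        have := ((h i j a x (x j) s').resolve_left fun hh => hs' hh.1).1
        rw [update_eq_self] at this
        exact this.symm
      · have := ((h i j a x (x j) s).resolve_left fun hh => hs hh.1).1
        rw [update_eq_self] at this
        exact this.symm
    intro x y hxy
    rw [main x, main y, hxy]
  have hex : ∀ j, ∃ i, k (update 0 j 0) i ≠ k (update 0 j 1) i := by
    intro j
    by_contra hcon
    push Not at hcon
    have := congrFun (hk (funext hcon)) j
    simp at this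
  choose τ hτ using hex
  have hinj : Injective τ := by
    intro j j' hjj
    by_contra hne
    refine hτ j' ?_
    rw [← hjj]
    refine hdep _ _ _ _ _ (hτ j) _ _ ?_
    rw [update_of_ne hne, update_of_ne hne]
  exact ⟨Equiv.ofBijective τ (Finite.injective_iff_bijective.1 hinj),
    fun j => hdep _ _ _ _ _ (hτ j)⟩

/-- An injective continuous function is strictly monotone; with a closed range it is onto, since
an extremal value could not be attained. -/
theorem exists_homeomorph_of_continuous_injective {f : ℝ → ℝ} (hc : Continuous f)
    (hi : Injective f) (hr : IsClosed (range f)) : ∃ e : ℝ ≃ₜ ℝ, ⇑e = f := by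
  have hmono : ∀ {f : ℝ → ℝ}, StrictMono f → Continuous f → IsClosed (range f) →
      ∃ e : ℝ ≃ₜ ℝ, ⇑e = f := by
    intro f hf hc hr
    have hoc : (range f).OrdConnected := isPreconnected_range hc |>.ordConnected
    have hbelow : ¬ BddBelow (range f) := fun hb => by
      obtain ⟨x, hx⟩ := hr.csInf_mem (range_nonempty f) hb
      have := csInf_le hb (mem_range_self (x - 1))
      rw [← hx] at this
      exact absurd (hf (sub_one_lt x)) (not_lt.2 this)
    have habove : ¬ BddAbove (range f) := fun hb => by
      obtain ⟨x, hx⟩ := hr.csSup_mem (range_nonempty f) hb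
      have := le_csSup hb (mem_range_self (x + 1))
      rw [← hx] at this
      exact absurd (hf (lt_add_one x)) (not_lt.2 this)
    have hsurj : Surjective f := fun y => by
      obtain ⟨u, hu, huy⟩ := not_bddBelow_iff.1 hbelow y
      obtain ⟨v, hv, hyv⟩ := not_bddAbove_iff.1 habove y
      exact hoc.out hu hv ⟨huy.le, hyv.le⟩
    exact ⟨(hf.orderIsoOfSurjective f hsurj).toHomeomorph, rfl⟩
  rcases hc.strictMono_of_inj hi with hm | ha
  · exact hmono hm hc hr
  · have hrange : range (fun x => f (-x)) = range f := by
      ext y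
      exact ⟨fun ⟨x, hx⟩ => ⟨-x, hx⟩, fun ⟨x, hx⟩ => ⟨-x, by simpa using hx⟩⟩
    obtain ⟨e, he⟩ := hmono (f := fun x => f (-x)) (fun x y hxy => ha (neg_lt_neg hxy))
      (hc.comp continuous_neg) (hrange ▸ hr)
    refine ⟨(Homeomorph.neg ℝ).trans e, ?_⟩
    funext x
    simp [he]

end Coordinates

/-! ### Location families and their matching -/

section Location

variable {ι : Type*} [Fintype ι]

/-- `ν` is a probability measure whose density is `exp (-F)` up to a normalizing constant, where
the potential `F` is continuous and has a strict global minimum, of value `0`, at the origin. -/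
structure HasPotential (ν : Measure (ι → ℝ)) (F : (ι → ℝ) → ℝ) : Prop where
  isProbabilityMeasure : IsProbabilityMeasure ν
  continuous : Continuous F
  map_zero : F 0 = 0
  eq_zero_of_nonpos : ∀ x, F x ≤ 0 → x = 0
  exists_density : ∃ C : ℝ, 0 < C ∧
    ν = volume.withDensity fun x => ENNReal.ofReal (C * Real.exp (-F x))

/-- The law of `a + X` for a random vector `X` of law `ν`. -/
noncomputable def shiftedLaw (ν : Measure (ι → ℝ)) (a : ι → ℝ) : Measure (ι → ℝ) :=
  ν.map fun x => a + x

instance isProbabilityMeasure_shiftedLaw (ν : Measure (ι → ℝ)) [IsProbabilityMeasure ν]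
    (a : ι → ℝ) : IsProbabilityMeasure (shiftedLaw ν a) :=
  Measure.isProbabilityMeasure_map (by fun_prop)

variable {ν : Measure (ι → ℝ)} {F : (ι → ℝ) → ℝ}

theorem HasPotential.exists_shiftedLaw_eq (hν : HasPotential ν F) : ∃ C : ℝ, 0 < C ∧
    ∀ a, shiftedLaw ν a = volume.withDensity fun x => ENNReal.ofReal (C * Real.exp (-F (x - a))) := by
  obtain ⟨C, hC, hd⟩ := hν.exists_density
  refine ⟨C, hC, fun a => ?_⟩
  ext S hS
  have he : MeasurableEmbedding fun x : ι → ℝ => a + x := measurableEmbedding_addLeft a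
  rw [shiftedLaw, Measure.map_apply (by fun_prop) hS, hd,
    withDensity_apply _ (measurable_const_add a hS), withDensity_apply _ hS,
    ← (measurePreserving_add_left volume a).setLIntegral_comp_preimage_emb he _ S]
  simp

theorem HasPotential.measurable_density (hν : HasPotential ν F) (C : ℝ) (a : ι → ℝ) :
    Measurable fun x => ENNReal.ofReal (C * Real.exp (-F (x - a))) := by
  have := hν.continuous
  exact (by fun_prop : Continuous fun x => C * Real.exp (-F (x - a))).measurable.ennreal_ofReal

theorem HasPotential.ae_of_ae_shiftedLaw (hν : HasPotential ν F) {a : ι → ℝ} {p : (ι → ℝ) → Prop}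
    (h : ∀ᵐ x ∂shiftedLaw ν a, p x) : ∀ᵐ x, p x := by
  obtain ⟨C, hC, hd⟩ := hν.exists_shiftedLaw_eq
  rw [hd, ae_withDensity_iff (hν.measurable_density C a)] at h
  filter_upwards [h] with x hx
  exact hx (by positivity)

/-- The location parameter is the unique maximizer of the density. -/
theorem HasPotential.shiftedLaw_injective (hν : HasPotential ν F) : Injective (shiftedLaw ν) := by
  intro a b hab
  obtain ⟨C, hC, hd⟩ := hν.exists_shiftedLaw_eq
  have hF := hν.continuous
  have hc : ∀ a, Continuous fun x => ENNReal.ofReal (C * Real.exp (-F (x - a))) := fun a =>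
    ENNReal.continuous_ofReal.comp (by fun_prop)
  rw [hd, hd, withDensity_eq_iff_of_sigmaFinite (hν.measurable_density C a).aemeasurable
    (hν.measurable_density C b).aemeasurable,
    Continuous.ae_eq_iff_eq volume (hc a) (hc b)] at hab
  have h1 := congrFun hab a
  simp only [sub_self, hν.map_zero] at h1
  rw [ENNReal.ofReal_eq_ofReal_iff (by positivity) (by positivity), mul_right_inj' hC.ne',
    Real.exp_eq_exp, neg_inj] at h1
  exact sub_eq_zero.1 (hν.eq_zero_of_nonpos _ h1.ge)

/-- Setwise continuity of a location family: Fatou's lemma, applied to a set and to its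
complement. -/
theorem HasPotential.tendsto_shiftedLaw (hν : HasPotential ν F) {u : ℕ → ι → ℝ} {a : ι → ℝ}
    (hu : Tendsto u atTop (𝓝 a)) {S : Set (ι → ℝ)} (hS : MeasurableSet S) :
    Tendsto (fun N => shiftedLaw ν (u N) S) atTop (𝓝 (shiftedLaw ν a S)) := by
  have := hν.isProbabilityMeasure
  obtain ⟨C, hC, hd⟩ := hν.exists_shiftedLaw_eq
  have hF := hν.continuous
  have hlim : ∀ S, MeasurableSet S →
      shiftedLaw ν a S ≤ liminf (fun N => shiftedLaw ν (u N) S) atTop := by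
    intro S hS
    simp only [hd, withDensity_apply _ hS]
    refine le_trans (le_of_eq ?_) (lintegral_liminf_le fun N => hν.measurable_density C (u N))
    refine lintegral_congr fun x => (Tendsto.liminf_eq ?_).symm
    have : Continuous fun a => ENNReal.ofReal (C * Real.exp (-F (x - a))) :=
      ENNReal.continuous_ofReal.comp (by fun_prop)
    exact (this.tendsto a).comp hu
  exact tendsto_of_le_liminf_of_limsup_le (hlim S hS)
    (limsup_measure_le_of_le_liminf_measure_compl hS (hlim _ hS.compl))

theorem HasPotential.shiftedLaw_eq_withDensity (hν : HasPotential ν F) (a b : ι → ℝ) :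
    shiftedLaw ν a = (shiftedLaw ν b).withDensity
      fun x => ENNReal.ofReal (Real.exp (F (x - b) - F (x - a))) := by
  obtain ⟨C, hC, hd⟩ := hν.exists_shiftedLaw_eq
  have hF := hν.continuous
  rw [hd, hd, ← withDensity_mul _ (hν.measurable_density C b)
    (by fun_prop : Continuous fun x => Real.exp (F (x - b) - F (x - a))).measurable.ennreal_ofReal]
  congr 1
  funext x
  rw [Pi.mul_apply, ← ENNReal.ofReal_mul (by positivity), mul_assoc, ← Real.exp_add]
  congr 3
  ring

/-- If a translate of `ν` puts more than half of its mass on a fixed ball, the translation is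
bounded: otherwise this ball, moved back, would avoid a ball that carries most of `ν`. -/
theorem exists_norm_le_of_half_lt_shiftedLaw (ν : Measure (ι → ℝ)) [IsProbabilityMeasure ν]
    (r : ℝ) : ∃ R, ∀ b, 1 / 2 < shiftedLaw ν b (Metric.closedBall 0 r) → ‖b‖ ≤ R := by
  have hmono : Monotone fun N : ℕ => Metric.closedBall (0 : ι → ℝ) N :=
    fun M N h => Metric.closedBall_subset_closedBall (Nat.cast_le.2 h)
  have ht := tendsto_measure_iUnion_atTop (μ := ν) hmono
  rw [Metric.iUnion_closedBall_nat, measure_univ] at ht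
  obtain ⟨M, hM⟩ := (ht.eventually (lt_mem_nhds (by simp : (1 / 2 : ENNReal) < 1))).exists
  refine ⟨r + M, fun b hb => ?_⟩
  by_contra! hlt
  rw [shiftedLaw, Measure.map_apply (by fun_prop) measurableSet_closedBall] at hb
  have hdisj : Disjoint ((fun x => b + x) ⁻¹' Metric.closedBall 0 r)
      (Metric.closedBall (0 : ι → ℝ) M) := by
    rw [Set.disjoint_left]
    intro x hx hx'
    simp only [mem_preimage, mem_closedBall_zero_iff] at hx hx'
    have := norm_sub_le (b + x) x
    rw [add_sub_cancel_right] at this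
    linarith
  have h1 := measure_union (μ := ν) hdisj measurableSet_closedBall
  have h2 : (1 / 2 : ENNReal) + 1 / 2 < 1 := by
    refine lt_of_lt_of_le (ENNReal.add_lt_add hb hM) ?_
    exact h1.symm.trans_le prob_le_one
  rw [ENNReal.add_halves] at h2
  exact lt_irrefl _ h2

end Location

theorem map_withDensity_comp {X Y : Type*} [MeasurableSpace X] [MeasurableSpace Y]
    (μ : Measure X) {g : X → Y} (hg : Measurable g) {f : Y → ENNReal} (hf : Measurable f) :
    (μ.withDensity fun x => f (g x)).map g = (μ.map g).withDensity f := by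
  ext S hS
  rw [Measure.map_apply hg hS, withDensity_apply _ (hg hS), withDensity_apply _ hS,
    setLIntegral_map hS hf hg]

section Matching

/-- The translates of `ν` by `a` and of `ν'` by `b` are indistinguishable after
mixing by `g` and `g'` respectively. -/
def Matches {ι Y : Type*} [MeasurableSpace Y] (ν ν' : Measure (ι → ℝ))
    (g g' : (ι → ℝ) → Y) (a b : ι → ℝ) : Prop :=
  (shiftedLaw ν a).map g = (shiftedLaw ν' b).map g'

theorem Matches.eq {ι Y : Type*} [MeasurableSpace Y] {ν ν' : Measure (ι → ℝ)}
    {g g' : (ι → ℝ) → Y} {a b : ι → ℝ} (h : Matches ν ν' g g' a b) :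
    (shiftedLaw ν a).map g = (shiftedLaw ν' b).map g' :=
  h

theorem Matches.symm {ι Y : Type*} [MeasurableSpace Y] {ν ν' : Measure (ι → ℝ)}
    {g g' : (ι → ℝ) → Y} {a b : ι → ℝ} (h : Matches ν ν' g g' a b) : Matches ν' ν g' g b a :=
  Eq.symm h

variable {ι Y : Type*} [Fintype ι] [MeasurableSpace Y] {ν ν' : Measure (ι → ℝ)}
  {F F' : (ι → ℝ) → ℝ} {g g' : (ι → ℝ) → Y}

theorem Matches.right_unique (hν' : HasPotential ν' F') (hg' : MeasurableEmbedding g')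
    {a b b' : ι → ℝ} (h : Matches ν ν' g g' a b) (h' : Matches ν ν' g g' a b') : b = b' := by
  refine hν'.shiftedLaw_injective ?_
  have := congrArg (Measure.comap g') (h.symm.trans h' : (shiftedLaw ν' b).map g' = _)
  rwa [hg'.comap_map, hg'.comap_map] at this

/-- Matching is a closed and proper relation: a law matched by a convergent sequence of
translates is tight, which confines the translation parameters to a compact set. -/
theorem Matches.exists_tendsto_subseq (hν : HasPotential ν F) (hν' : HasPotential ν' F')
    (hg : MeasurableEmbedding g) (hg' : MeasurableEmbedding g') {u v : ℕ → ι → ℝ} {a : ι → ℝ}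
    (hu : Tendsto u atTop (𝓝 a)) (h : ∀ N, Matches ν ν' g g' (u N) (v N)) :
    ∃ (b : ι → ℝ) (φ : ℕ → ℕ), StrictMono φ ∧ Tendsto (v ∘ φ) atTop (𝓝 b) ∧
      Matches ν ν' g g' a b := by
  have := hν.isProbabilityMeasure
  have := hν'.isProbabilityMeasure
  set m := (shiftedLaw ν a).map g with hm
  have hlim : ∀ S, MeasurableSet S →
      Tendsto (fun N => (shiftedLaw ν' (v N)).map g' S) atTop (𝓝 (m S)) := by
    intro S hS
    simp_rw [fun N => (h N).symm.eq, hm, Measure.map_apply hg.measurable hS]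
    exact hν.tendsto_shiftedLaw hu (hg.measurable hS)
  have hrange : m (range g') = 1 := by
    refine tendsto_nhds_unique (hlim _ hg'.measurableSet_range) ?_
    simp only [Measure.map_apply hg'.measurable hg'.measurableSet_range, preimage_range,
      measure_univ]
    exact tendsto_const_nhds
  have hmono : Monotone fun N : ℕ => g' '' Metric.closedBall (0 : ι → ℝ) N :=
    fun M N h => image_mono (Metric.closedBall_subset_closedBall (Nat.cast_le.2 h))
  have ht := tendsto_measure_iUnion_atTop (μ := m) hmono
  rw [← image_iUnion, Metric.iUnion_closedBall_nat, image_univ, hrange] at ht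
  obtain ⟨M, hM⟩ := (ht.eventually (lt_mem_nhds (by simp : (1 / 2 : ENNReal) < 1))).exists
  have hMm := hg'.measurableSet_image.2 (measurableSet_closedBall (x := (0 : ι → ℝ)) (ε := M))
  obtain ⟨R, hR⟩ := exists_norm_le_of_half_lt_shiftedLaw ν' M
  have hbdd : ∀ᶠ N in atTop, v N ∈ Metric.closedBall (0 : ι → ℝ) R := by
    filter_upwards [(hlim _ hMm).eventually (lt_mem_nhds hM)] with N hN
    rw [Measure.map_apply hg'.measurable hMm, preimage_image_eq _ hg'.injective] at hN
    exact mem_closedBall_zero_iff.2 (hR _ hN)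
  obtain ⟨b, -, φ, hφ, hb⟩ :=
    (isCompact_closedBall (0 : ι → ℝ) R).tendsto_subseq' hbdd.frequently
  refine ⟨b, φ, hφ, hb, ?_⟩
  ext S hS
  refine tendsto_nhds_unique ((hlim S hS).comp hφ.tendsto_atTop) ?_
  simp only [comp_def, Measure.map_apply hg'.measurable hS]
  exact hν'.tendsto_shiftedLaw hb (hg'.measurable hS)

/-- If the matched parameters are dense, then matching is the graph of a continuous injective
map defined everywhere. -/
theorem exists_continuous_matching (hν : HasPotential ν F) (hν' : HasPotential ν' F')
    (hg : MeasurableEmbedding g) (hg' : MeasurableEmbedding g')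
    (hd : Dense {a | ∃ b, Matches ν ν' g g' a b}) :
    ∃ k : (ι → ℝ) → ι → ℝ, Continuous k ∧ Injective k ∧ ∀ a, Matches ν ν' g g' a (k a) := by
  have hall : ∀ a, ∃ b, Matches ν ν' g g' a b := by
    intro a
    obtain ⟨u, hu, hua⟩ := mem_closure_iff_seq_limit.1 (hd a)
    choose v hv using hu
    obtain ⟨b, -, -, -, hb⟩ := Matches.exists_tendsto_subseq hν hν' hg hg' hua hv
    exact ⟨b, hb⟩
  choose k hk using hall
  refine ⟨k, ?_, ?_, hk⟩
  · refine continuous_iff_seqContinuous.2 fun u a hu => ?_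
    refine tendsto_of_subseq_tendsto fun ns hns => ?_
    obtain ⟨b, φ, -, hb, hab⟩ :=
      Matches.exists_tendsto_subseq hν hν' hg hg' (hu.comp hns) fun N => hk (u (ns N))
    refine ⟨φ, ?_⟩
    rw [(hk a).right_unique hν' hg' hab]
    exact hb
  · intro a a' haa
    exact (hk a).symm.right_unique hν hg (haa ▸ (hk a').symm)

/-- Almost every learned observation lies in the range of the true mixing function. -/
theorem Matches.ae_mem_range (hν' : HasPotential ν' F') (hg : MeasurableEmbedding g)
    (hg' : MeasurableEmbedding g') {a b : ι → ℝ} (h : Matches ν ν' g g' a b) :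
    ∀ᵐ w, g' w ∈ range g := by
  refine hν'.ae_of_ae_shiftedLaw (a := b) (ae_of_ae_map hg'.measurable.aemeasurable ?_)
  rw [← h]
  exact (ae_map_mem_range g hg.measurableSet_range _)

/-- Comparing densities at two matched pairs: the normalizing constants and the Jacobian of the
latent change of variables `r ∘ g'` cancel in the quotients. -/
theorem Matches.ae_sub_eq_sub (hν : HasPotential ν F) (hν' : HasPotential ν' F')
    (hg : MeasurableEmbedding g) (hg' : MeasurableEmbedding g') {r r' : Y → ι → ℝ}
    (hr : Measurable r) (hrg : ∀ x, r (g x) = x) (hr' : Measurable r')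
    (hrg' : ∀ x, r' (g' x) = x) {a₀ b₀ a b : ι → ℝ}
    (h₀ : Matches ν ν' g g' a₀ b₀) (h : Matches ν ν' g g' a b) :
    ∀ᵐ w, F (r (g' w) - a) - F (r (g' w) - a₀) = F' (w - b) - F' (w - b₀) := by
  have := hν'.isProbabilityMeasure
  have hF := hν.continuous
  have hF' := hν'.continuous
  set ρ : Y → ENNReal := fun y => ENNReal.ofReal (Real.exp (F (r y - a₀) - F (r y - a)))
  set ρ' : Y → ENNReal := fun y => ENNReal.ofReal (Real.exp (F' (r' y - b₀) - F' (r' y - b)))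
  have hρ : Measurable ρ :=
    ((by fun_prop : Continuous fun x => Real.exp (F (x - a₀) - F (x - a))).measurable.comp
      hr).ennreal_ofReal
  have hρ' : Measurable ρ' :=
    ((by fun_prop : Continuous fun x => Real.exp (F' (x - b₀) - F' (x - b))).measurable.comp
      hr').ennreal_ofReal
  have e : (shiftedLaw ν a).map g = ((shiftedLaw ν a₀).map g).withDensity ρ := by
    rw [← map_withDensity_comp _ hg.measurable hρ, hν.shiftedLaw_eq_withDensity a a₀]
    simp only [ρ, hrg]
  have e' : (shiftedLaw ν' b).map g' = ((shiftedLaw ν' b₀).map g').withDensity ρ' := by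
    rw [← map_withDensity_comp _ hg'.measurable hρ', hν'.shiftedLaw_eq_withDensity b b₀]
    simp only [ρ', hrg']
  rw [h, h₀, e'] at e
  have : IsProbabilityMeasure ((shiftedLaw ν' b₀).map g') :=
    Measure.isProbabilityMeasure_map hg'.measurable.aemeasurable
  rw [withDensity_eq_iff_of_sigmaFinite hρ'.aemeasurable hρ.aemeasurable] at e
  filter_upwards [hν'.ae_of_ae_shiftedLaw (ae_of_ae_map hg'.measurable.aemeasurable e)] with w hw
  simp only [ρ, ρ', hrg'] at hw
  rw [ENNReal.ofReal_eq_ofReal_iff (by positivity) (by positivity), Real.exp_eq_exp] at hw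
  linarith

end Matching

/-! ### Identification of the change of latent variables -/

/-- If densely many noise laws of the one model are matched by noise laws of the other, then the
mixing functions agree up to a permutation and componentwise homeomorphisms. -/
theorem eqUpToPermComponentwise_of_dense_matches {n m : ℕ} {ν ν' : Measure (Fin n → ℝ)}
    {α lam α' lam' : Fin n → ℝ} {g g' : (Fin n → ℝ) → Fin m → ℝ}
    (hν : HasPotential ν (potential α lam)) (hν' : HasPotential ν' (potential α' lam'))
    (h0 : ∀ i, 0 < α' i) (h2 : ∀ i, α' i < 2) (hl : ∀ i, 0 < lam' i)
    (hg : MeasurableEmbedding g) (hg' : MeasurableEmbedding g')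
    (hd : Dense {a | ∃ b, Matches ν ν' g g' a b}) : EqUpToPermComponentwise g g' := by
  obtain ⟨k, hkc, hki, hk⟩ := exists_continuous_matching hν hν' hg hg' hd
  obtain ⟨r, hr, hrg⟩ := hg.exists_measurable_extend measurable_id fun _ => inferInstance
  obtain ⟨r', hr', hrg'⟩ := hg'.exists_measurable_extend measurable_id fun _ => inferInstance
  have hrg : ∀ x, r (g x) = x := congrFun hrg
  have hrg' : ∀ x, r' (g' x) = x := congrFun hrg'
  set h : (Fin n → ℝ) → Fin n → ℝ := fun w => r (g' w)
  have hF := hν.continuous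
  have hF' := hν'.continuous
  have hW : ∀ᵐ w, ∀ a a', potential α lam (h w - a) - potential α lam (h w - a')
      = potential α' lam' (w - k a) - potential α' lam' (w - k a') := by
    have h1 : ∀ᵐ w, ∀ N, potential α lam (h w - TopologicalSpace.denseSeq _ N)
        - potential α lam (h w - 0)
        = potential α' lam' (w - k (TopologicalSpace.denseSeq _ N))
          - potential α' lam' (w - k 0) :=
      ae_all_iff.2 fun N => (hk 0).ae_sub_eq_sub hν hν' hg hg' hr hrg hr' hrg' (hk _)
    filter_upwards [h1] with w hw a a'
    have h2 : (fun a => potential α lam (h w - a) - potential α lam (h w - 0))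
        = fun a => potential α' lam' (w - k a) - potential α' lam' (w - k 0) :=
      Continuous.ext_on (TopologicalSpace.denseRange_denseSeq _) (by fun_prop) (by fun_prop)
        (by rintro _ ⟨N, rfl⟩; exact hw N)
    have e := congrFun h2 a
    have e' := congrFun h2 a'
    linarith
  have hupd : ∀ (j : Fin n) (a c : Fin n → ℝ) (s s' : ℝ) (w : Fin n → ℝ),
      potential α' lam' (w - k (update a j s)) - potential α' lam' (w - k (update a j s'))
      = potential α' lam' (w - k (update c j s)) - potential α' lam' (w - k (update c j s')) := by
    intro j a c s s'
    refine congrFun ((Continuous.ae_eq_iff_eq volume (by fun_prop) (by fun_prop)).1 ?_)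
    filter_upwards [hW] with w hw
    rw [← hw, ← hw, potential_sub_update_sub, potential_sub_update_sub]
  obtain ⟨τ, hτ⟩ := exists_perm_of_apply_update_eq_or_eq hki fun i j a c s s' =>
    apply_update_eq_or_eq h0 h2 hl (hupd j a c s s') i
  set κ : Fin n → ℝ → ℝ := fun j s => k (update 0 j s) (τ j) with hκ
  have hkκ : ∀ a j, k a (τ j) = κ j (a j) := fun a j => hτ j _ _ (by simp)
  have hupdc : ∀ j : Fin n, Continuous fun s : ℝ => update (0 : Fin n → ℝ) j s := fun j =>
    continuous_const.update j continuous_id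
  have hhomeo : ∀ j, ∃ e : ℝ ≃ₜ ℝ, ⇑e = κ j := by
    intro j
    have hkupd : ∀ s i, k (update 0 j s) (τ i) = if i = j then κ j s else k 0 (τ i) := by
      intro s i
      split_ifs with hij
      · rw [hij]
      · exact hτ i _ _ (by simp [update_of_ne hij])
    refine exists_homeomorph_of_continuous_injective
      ((continuous_apply (τ j)).comp (hkc.comp (hupdc j))) ?_ ?_
    · intro s s' hss
      have : k (update 0 j s) = k (update 0 j s') := by
        funext i
        obtain ⟨i, rfl⟩ := τ.surjective i
        rw [hkupd, hkupd, hss]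
      simpa using congrFun (hki this) j
    · refine IsSeqClosed.isClosed fun v x hv hvx => ?_
      choose s hs using hv
      -- The other coordinates of `k (update 0 j (s N))` are constant, so it converges.
      have hlim : Tendsto (fun N => k (update 0 j (s N))) atTop
          (𝓝 fun i => if τ.symm i = j then x else k 0 i) := by
        refine tendsto_pi_nhds.2 fun i => ?_
        obtain ⟨i, rfl⟩ := τ.surjective i
        simp only [hkupd, Equiv.symm_apply_apply]
        split_ifs with hij
        · simpa only [hs] using hvx
        · exact tendsto_const_nhds
      obtain ⟨a, -, -, -, ha⟩ := Matches.exists_tendsto_subseq hν' hν hg' hg hlim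
        fun N => (hk (update 0 j (s N))).symm
      have hka := congrFun ((hk a).right_unique hν' hg' ha.symm) (τ j)
      rw [hkκ, Equiv.symm_apply_apply, if_pos rfl] at hka
      exact ⟨a j, hka⟩
  choose e he using hhomeo
  have hae : ∀ᵐ w, g' w = g fun j => (e j).symm (w (τ j)) := by
    filter_upwards [hW, (hk 0).ae_mem_range hν' hg hg'] with w hw ⟨x, hx⟩
    have hkinv : k (fun j => (e j).symm (w (τ j))) = w := by
      funext i
      obtain ⟨j, rfl⟩ := τ.surjective i
      rw [hkκ, ← he, Homeomorph.apply_symm_apply]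
    have h3 := hw (h w) fun j => (e j).symm (w (τ j))
    rw [hkinv, sub_self, sub_self, hν.map_zero, hν'.map_zero] at h3
    have h4 : h w = fun j => (e j).symm (w (τ j)) := by
      refine sub_eq_zero.1 (hν.eq_zero_of_nonpos _ ?_)
      linarith [potential_nonneg (α := α') hl (w - k (h w))]
    rw [← h4, ← hx]
    simp only [h, ← hx, hrg]
  refine ⟨τ, fun j => (e j).symm, hae, fun hgc hgc' => ?_⟩
  exact congrFun ((Continuous.ae_eq_iff_eq volume hgc' (hgc.comp (by fun_prop))).1 hae)

/-! ### Noise laws and conditional laws of the autoregression -/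

theorem continuous_genLaplacePDF {α : ℝ} (h0 : 0 < α) (lam : ℝ) :
    Continuous (genLaplacePDF α lam) := by
  unfold genLaplacePDF
  have : Continuous fun x : ℝ => |x| ^ α := continuous_abs.rpow_const fun _ => Or.inr h0.le
  fun_prop

theorem genLaplacePDF_nonneg {α lam : ℝ} (h0 : 0 < α) (hl : 0 < lam) (x : ℝ) :
    0 ≤ genLaplacePDF α lam x := by
  have := Real.Gamma_pos_of_pos (one_div_pos.2 h0)
  unfold genLaplacePDF
  positivity

/-- The joint law of independent generalized Laplacian noises. -/
noncomputable def noiseLaw {n : ℕ} (α lam : Fin n → ℝ) : Measure (Fin n → ℝ) :=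
  Measure.pi fun i => genLaplace (α i) (lam i)

theorem noiseLaw_eq_withDensity {n : ℕ} {α lam : Fin n → ℝ} (h0 : ∀ i, 0 < α i)
    (hl : ∀ i, 0 < lam i) (hp : ∀ i, IsProbabilityMeasure (genLaplace (α i) (lam i))) :
    noiseLaw α lam
      = volume.withDensity fun x => ENNReal.ofReal (∏ i, genLaplacePDF (α i) (lam i) (x i)) := by
  refine Measure.pi_eq fun s hs => ?_
  set f : Fin n → ℝ → ℝ := fun i => (s i).indicator (genLaplacePDF (α i) (lam i)) with hf
  have hf0 : ∀ i x, 0 ≤ f i x := fun i x =>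
    indicator_nonneg (fun x _ => genLaplacePDF_nonneg (h0 i) (hl i) x) x
  have hfm : ∀ i, Measurable (f i) := fun i =>
    (continuous_genLaplacePDF (h0 i) (lam i)).measurable.indicator (hs i)
  have hlint : ∀ i, genLaplace (α i) (lam i) (s i) = ∫⁻ x, ENNReal.ofReal (f i x) := by
    intro i
    rw [genLaplace, withDensity_apply _ (hs i), ← lintegral_indicator (hs i)]
    refine lintegral_congr fun x => ?_
    by_cases hx : x ∈ s i <;> simp [hf, hx]
  have hfi : ∀ i, Integrable (f i) := fun i => by
    refine ⟨(hfm i).aestronglyMeasurable, ?_⟩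
    rw [hasFiniteIntegral_iff_ofReal (ae_of_all _ (hf0 i)), ← hlint]
    exact measure_lt_top _ _
  have hprod : Integrable fun x : Fin n → ℝ => ∏ i, f i (x i) := Integrable.fintype_prod hfi
  calc (volume.withDensity fun x : Fin n → ℝ =>
        ENNReal.ofReal (∏ i, genLaplacePDF (α i) (lam i) (x i))) (univ.pi s)
      = ∫⁻ x : Fin n → ℝ, ENNReal.ofReal (∏ i, f i (x i)) := by
        rw [withDensity_apply _ (MeasurableSet.univ_pi hs),
          ← lintegral_indicator (MeasurableSet.univ_pi hs)]
        refine lintegral_congr fun x => ?_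
        by_cases hx : x ∈ univ.pi s
        · rw [indicator_of_mem hx]
          simp only [hf, indicator_of_mem (hx _ (mem_univ _))]
        · rw [indicator_of_notMem hx]
          simp only [mem_univ_pi, not_forall] at hx
          obtain ⟨i, hi⟩ := hx
          rw [Finset.prod_eq_zero (Finset.mem_univ i) (by simp [hf, hi]), ENNReal.ofReal_zero]
    _ = ENNReal.ofReal (∫ x : Fin n → ℝ, ∏ i, f i (x i)) :=
        (ofReal_integral_eq_lintegral_ofReal hprod
          (ae_of_all _ fun x => Finset.prod_nonneg fun i _ => hf0 i (x i))).symm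
    _ = ∏ i, genLaplace (α i) (lam i) (s i) := by
        rw [integral_fintype_prod_volume_eq_prod,
          ENNReal.ofReal_prod_of_nonneg fun i _ => integral_nonneg (hf0 i)]
        refine Finset.prod_congr rfl fun i _ => ?_
        rw [hlint, ofReal_integral_eq_lintegral_ofReal (hfi i) (ae_of_all _ (hf0 i))]

theorem hasPotential_noiseLaw {n : ℕ} {α lam : Fin n → ℝ} (h0 : ∀ i, 0 < α i)
    (hl : ∀ i, 0 < lam i) (hp : ∀ i, IsProbabilityMeasure (genLaplace (α i) (lam i))) :
    HasPotential (noiseLaw α lam) (potential α lam) where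
  isProbabilityMeasure := by unfold noiseLaw; infer_instance
  continuous := continuous_potential h0
  map_zero := potential_zero h0
  eq_zero_of_nonpos _ := eq_zero_of_potential_nonpos h0 hl
  exists_density := by
    refine ⟨∏ i, (α i * lam i ^ (1 / α i) / (2 * Real.Gamma (1 / α i))),
      Finset.prod_pos fun i _ => ?_, ?_⟩
    · have := Real.Gamma_pos_of_pos (one_div_pos.2 (h0 i))
      have := Real.rpow_pos_of_pos (hl i) (1 / α i)
      have := h0 i
      positivity
    · rw [noiseLaw_eq_withDensity h0 hl hp]
      congr 1
      funext x
      simp only [genLaplacePDF, potential, Finset.prod_mul_distrib, ← Real.exp_sum,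
        ← Finset.sum_neg_distrib, neg_mul]

section Autoregression

/-- The kernel sending `a` to the law of `a + X` for a random vector `X` of law `ν`. -/
noncomputable def shiftedKernel {ι : Type*} (ν : Measure (ι → ℝ)) [SFinite ν] :
    Kernel (ι → ℝ) (ι → ℝ) where
  toFun := shiftedLaw ν
  measurable' := by
    refine Measure.measurable_of_measurable_coe _ fun S hS => ?_
    simp only [shiftedLaw, Measure.map_apply (measurable_const_add _) hS]
    exact measurable_measure_prodMk_left (measurable_fst.add measurable_snd hS)

instance {ι : Type*} (ν : Measure (ι → ℝ)) [IsProbabilityMeasure ν] :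
    IsMarkovKernel (shiftedKernel ν) :=
  ⟨fun a => isProbabilityMeasure_shiftedLaw ν a⟩

/-- The joint law of `X` and of a function of `c (X) + e`, with `e` independent of `X`,
disintegrated along `X`. -/
theorem map_prodMk_comp_add_eq_compProd {Ω Y Z ι : Type*} [Finite ι] [MeasurableSpace Ω]
    [MeasurableSpace Y] [MeasurableSpace Z] {P : Measure Ω} [IsProbabilityMeasure P] {X : Ω → Y}
    (hX : Measurable X) {e : Ω → ι → ℝ} (he : Measurable e) (hXe : IndepFun X e P)
    {ν : Measure (ι → ℝ)} [IsProbabilityMeasure ν] (hν : P.map e = ν) {c : Y → ι → ℝ}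
    (hc : Measurable c) {g : (ι → ℝ) → Z} (hg : Measurable g) :
    P.map (fun ω => (X ω, g (c (X ω) + e ω)))
      = (P.map X) ⊗ₘ (((shiftedKernel ν).comap c hc).map g) := by
  have : IsProbabilityMeasure (P.map X) := Measure.isProbabilityMeasure_map hX.aemeasurable
  have hm : Measurable fun p : Y × (ι → ℝ) => (p.1, g (c p.1 + p.2)) := by fun_prop
  have h1 : P.map (fun ω => (X ω, g (c (X ω) + e ω)))
      = ((P.map X).prod ν).map fun p => (p.1, g (c p.1 + p.2)) := by
    rw [← hν, ← (indepFun_iff_map_prod_eq_prod_map_map hX.aemeasurable he.aemeasurable).1 hXe,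
      Measure.map_map hm (hX.prodMk he)]
    rfl
  rw [h1]
  ext S hS
  rw [Measure.map_apply hm hS, Measure.prod_apply (hm hS), Measure.compProd_apply hS]
  refine lintegral_congr fun y => ?_
  rw [Kernel.map_apply' _ hg _ (measurable_prodMk_left hS), Kernel.comap_apply]
  change _ = shiftedLaw ν (c y) _
  rw [shiftedLaw, Measure.map_apply (measurable_const_add _) (hg (measurable_prodMk_left hS))]
  rfl

/-- Independence of a triple from its pairwise pieces. -/
theorem IndepFun.prodMk_left_of_right {Ω X U V : Type*} [MeasurableSpace Ω] [MeasurableSpace X]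
    [MeasurableSpace U] [MeasurableSpace V] {P : Measure Ω} [IsProbabilityMeasure P] {x : Ω → X}
    {u : Ω → U} {v : Ω → V} (hx : Measurable x) (hu : Measurable u) (hv : Measurable v)
    (h : IndepFun x (fun ω => (u ω, v ω)) P) (huv : IndepFun u v P) :
    IndepFun (fun ω => (x ω, u ω)) v P := by
  have := Measure.isProbabilityMeasure_map (μ := P) hx.aemeasurable
  have := Measure.isProbabilityMeasure_map (μ := P) hu.aemeasurable
  have := Measure.isProbabilityMeasure_map (μ := P) hv.aemeasurable
  have hxu : IndepFun x u P := h.comp measurable_id measurable_fst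
  rw [indepFun_iff_map_prod_eq_prod_map_map (hx.prodMk hu).aemeasurable hv.aemeasurable,
    (indepFun_iff_map_prod_eq_prod_map_map hx.aemeasurable hu.aemeasurable).1 hxu]
  rw [indepFun_iff_map_prod_eq_prod_map_map hx.aemeasurable (hu.prodMk hv).aemeasurable,
    (indepFun_iff_map_prod_eq_prod_map_map hu.aemeasurable hv.aemeasurable).1 huv,
    ← Measure.prodAssoc_prod] at h
  have h' := congrArg (Measure.map MeasurableEquiv.prodAssoc.symm) h
  rw [Measure.map_map (by fun_prop) (by fun_prop), Measure.map_map (by fun_prop) (by fun_prop),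
    MeasurableEquiv.symm_comp_self, Measure.map_id] at h'
  exact h'

/-- The deterministic part of the transition: the next latent vector is predicted from the `L`
preceding ones, `w τ` being the vector at lag `τ + 1`. -/
def drift {n L : ℕ} (B : Fin L → Matrix (Fin n) (Fin n) ℝ) (w : Fin L → Fin n → ℝ) : Fin n → ℝ :=
  ∑ τ, (B τ).mulVec (w τ)

theorem continuous_drift {n L : ℕ} (B : Fin L → Matrix (Fin n) (Fin n) ℝ) :
    Continuous (drift B) := by
  unfold drift
  fun_prop

theorem surjective_drift {n L : ℕ} {B : Fin L → Matrix (Fin n) (Fin n) ℝ}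
    (hB : ∃ τ, (B τ).rank = n) : Surjective (drift B) := by
  obtain ⟨τ, hτ⟩ := hB
  have hsurj : Surjective (B τ).mulVecLin := by
    rw [← LinearMap.range_eq_top]
    refine Submodule.eq_top_of_finrank_eq ?_
    rw [Module.finrank_fin_fun]
    exact hτ
  intro u
  obtain ⟨v, hv⟩ := hsurj u
  refine ⟨Pi.single τ v, ?_⟩
  rw [drift, Finset.sum_eq_single τ]
  · simpa using hv
  · intro σ _ hσ
    simp [Pi.single_eq_of_ne hσ]
  · simp

namespace IsGenLaplaceVAR

variable {Ω : Type*} [MeasurableSpace Ω] {P : Measure Ω} [IsProbabilityMeasure P] {n L : ℕ}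
  {B : Fin L → Matrix (Fin n) (Fin n) ℝ} {α lam : Fin n → ℝ} {z ε : ℕ → Ω → Fin n → ℝ}

theorem isProbabilityMeasure_genLaplace (hz : IsGenLaplaceVAR P B α lam z ε) (i : Fin n) :
    IsProbabilityMeasure (genLaplace (α i) (lam i)) := by
  rw [← hz.noise_law L le_rfl i]
  have := hz.measurable_noise L le_rfl
  exact Measure.isProbabilityMeasure_map (by fun_prop)

theorem hasPotential (hz : IsGenLaplaceVAR P B α lam z ε) :
    HasPotential (noiseLaw α lam) (potential α lam) :=
  hasPotential_noiseLaw hz.shape_pos hz.lam_pos hz.isProbabilityMeasure_genLaplace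

theorem map_noise (hz : IsGenLaplaceVAR P B α lam z ε) {t : ℕ} (ht : L ≤ t) :
    P.map (ε t) = noiseLaw α lam := by
  have hi : iIndepFun (fun i ω => ε t ω i) P :=
    hz.noise_indep.precomp (g := fun i => (⟨t, ht⟩, i)) fun i j hij => (Prod.ext_iff.1 hij).2
  have hm := hz.measurable_noise t ht
  rw [iIndepFun_iff_map_fun_eq_pi_map fun i => by fun_prop] at hi
  rw [noiseLaw]
  simp only [hz.noise_law t ht] at hi
  exact hi

omit [IsProbabilityMeasure P] in
/-- Before time `t`, the latent process is a function of the initial block and of the noises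
before time `t`. -/
theorem exists_latent_eq (hz : IsGenLaplaceVAR P B α lam z ε) (t s : ℕ) (hs : s < t) :
    ∃ Φ : (Fin L → Fin n → ℝ) × ({s : ℕ // L ≤ s ∧ s < t} → Fin n → ℝ) → Fin n → ℝ,
      Measurable Φ ∧ ∀ᵐ ω ∂P, z s ω = Φ (fun s => z s ω, fun s => ε s ω) := by
  induction s using Nat.strong_induction_on with
  | _ s ih =>
    by_cases hsL : s < L
    · exact ⟨fun p => p.1 ⟨s, hsL⟩, by fun_prop, ae_of_all _ fun ω => rfl⟩
    · have hLs : L ≤ s := not_lt.1 hsL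
      choose Φ hΦm hΦ using fun τ : Fin L => ih (s - (τ + 1)) (by omega) (by omega)
      refine ⟨fun p => drift B (fun τ => Φ τ p) + p.2 ⟨s, hLs, hs⟩, ?_, ?_⟩
      · exact ((continuous_drift B).measurable.comp (measurable_pi_lambda _ hΦm)).add
          ((measurable_pi_apply _).comp measurable_snd)
      · filter_upwards [hz.transition s hLs, ae_all_iff.2 hΦ] with ω h1 h2
        rw [h1, drift]
        simp only [h2]

theorem indepFun_past_noise (hz : IsGenLaplaceVAR P B α lam z ε) {t : ℕ} (ht : L ≤ t) :
    IndepFun (fun ω (s : Fin t) => z s ω) (ε t) P := by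
  have hnoise : IndepFun (fun ω (s : {s : ℕ // L ≤ s ∧ s < t}) => ε s ω) (ε t) P := by
    have hcoord : ∀ p : {s : ℕ // L ≤ s} × Fin n, Measurable fun ω => ε p.1 ω p.2 := fun p =>
      (measurable_pi_apply _).comp (hz.measurable_noise _ p.1.2)
    have hdisj : Disjoint {p : {s : ℕ // L ≤ s} × Fin n | p.1.1 < t} {p | p.1.1 = t} :=
      Set.disjoint_left.2 fun p hp hp' => hp.ne hp'
    have h1 := indep_iSup_of_disjoint (fun p => (hcoord p).comap_le) hz.noise_indep hdisj
    refine indep_of_indep_of_le_left (indep_of_indep_of_le_right h1 ?_) ?_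
    · refine Measurable.comap_le ((@measurable_pi_iff _ _ _ (_) _ _).2 fun i => ?_)
      refine (comap_measurable _).mono ?_ le_rfl
      exact le_iSup₂_of_le (⟨t, ht⟩, i) rfl le_rfl
    · refine Measurable.comap_le ((@measurable_pi_iff _ _ _ (_) _ _).2 fun s =>
        (@measurable_pi_iff _ _ _ (_) _ _).2 fun i => ?_)
      refine (comap_measurable _).mono ?_ le_rfl
      exact le_iSup₂_of_le (⟨s, s.2.1⟩, i) s.2.2 le_rfl
  have hinit := hz.initial_indep.comp (φ := id)
    (ψ := fun e => (fun s : {s : ℕ // L ≤ s ∧ s < t} => e ⟨s, s.2.1⟩, e ⟨t, ht⟩))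
    measurable_id (by fun_prop)
  have hpair := IndepFun.prodMk_left_of_right
    (measurable_pi_lambda (fun ω (s : Fin L) => z s ω) fun s => hz.measurable_latent s)
    (measurable_pi_lambda (fun ω (s : {s : ℕ // L ≤ s ∧ s < t}) => ε s ω)
      fun s => hz.measurable_noise s s.2.1) (hz.measurable_noise t ht)
    hinit hnoise
  choose Φ hΦm hΦ using fun s : Fin t => hz.exists_latent_eq t s s.2
  refine (hpair.comp (measurable_pi_lambda _ hΦm) measurable_id).congr ?_ .rfl
  filter_upwards [ae_all_iff.2 hΦ] with ω h1
  funext s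
  exact (h1 s).symm

/-- The conditional law of an observation given all previous ones. -/
theorem map_past_next (hz : IsGenLaplaceVAR P B α lam z ε) [IsProbabilityMeasure (noiseLaw α lam)]
    {t : ℕ} (ht : L ≤ t) {Y : Type*} [MeasurableSpace Y] {g : (Fin n → ℝ) → Y} (hg : Measurable g)
    {r : Y → Fin n → ℝ} (hrg : ∀ x, r (g x) = x)
    {c : (Fin t → Y) → Fin n → ℝ} (hc : Measurable c)
    (hcr : ∀ y, c y = drift B fun τ => r (y ⟨t - (τ + 1), by omega⟩)) :
    P.map (fun ω => (fun s : Fin t => g (z s ω), g (z t ω)))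
      = (P.map fun ω (s : Fin t) => g (z s ω)) ⊗ₘ
        (((shiftedKernel (noiseLaw α lam)).comap c hc).map g) := by
  have hm := hz.measurable_latent
  have hX : Measurable fun ω (s : Fin t) => g (z s ω) :=
    measurable_pi_lambda _ fun s => hg.comp (hm s)
  have hind : IndepFun (fun ω (s : Fin t) => g (z s ω)) (ε t) P :=
    (hz.indepFun_past_noise ht).comp (φ := fun y s => g (y s)) (ψ := id)
      (by fun_prop) measurable_id
  rw [← map_prodMk_comp_add_eq_compProd hX (hz.measurable_noise t ht) hind (hz.map_noise ht) hc hg]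
  refine Measure.map_congr ?_
  filter_upwards [hz.transition t ht] with ω hω
  rw [hcr, hω, drift]
  simp only [hrg]

end IsGenLaplaceVAR

end Autoregression

/-! ### Support of the drift and observational equivalence -/

namespace IsGenLaplaceVAR

variable {Ω : Type*} [MeasurableSpace Ω] {P : Measure Ω} [IsProbabilityMeasure P] {n L : ℕ}
  {B : Fin L → Matrix (Fin n) (Fin n) ℝ} {α lam : Fin n → ℝ} {z ε : ℕ → Ω → Fin n → ℝ}

/-- After the initial block, the latent process visits any prescribed open sets with positive
probability: whatever the past, the next noise has a positive density. -/
theorem measure_forall_mem_ne_zero (hz : IsGenLaplaceVAR P B α lam z ε)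
    {U : ℕ → Set (Fin n → ℝ)} (hU : ∀ s, IsOpen (U s)) (hne : ∀ s, (U s).Nonempty) (q : ℕ) :
    P {ω | ∀ s, L ≤ s → s < L + q → z s ω ∈ U s} ≠ 0 := by
  induction q with
  | zero =>
    have : {ω | ∀ s, L ≤ s → s < L + 0 → z s ω ∈ U s} = univ :=
      eq_univ_of_forall fun ω s h1 h2 => by omega
    rw [this]
    simp
  | succ q ih =>
    have hν := hz.hasPotential
    have := hν.isProbabilityMeasure
    have hm := hz.measurable_latent
    have hX : Measurable fun ω (s : Fin (L + q)) => z s ω := measurable_pi_lambda _ fun s => hm s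
    have := Measure.isProbabilityMeasure_map (μ := P) hX.aemeasurable
    have hc : Measurable fun y : Fin (L + q) → Fin n → ℝ =>
        drift B fun τ => y ⟨L + q - (τ + 1), by omega⟩ :=
      (continuous_drift B).measurable.comp (by fun_prop)
    have hlaw := hz.map_past_next (Nat.le_add_right L q) (g := id) measurable_id (r := id)
      (fun _ => rfl) hc fun _ => rfl
    simp only [id] at hlaw
    set S : Set (Fin (L + q) → Fin n → ℝ) := univ.pi fun s => if L ≤ (s : ℕ) then U s else univ
    have hS : MeasurableSet S := MeasurableSet.univ_pi fun s => by
      split_ifs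
      exacts [(hU s).measurableSet, MeasurableSet.univ]
    have hpre : {ω | ∀ s, L ≤ s → s < L + q → z s ω ∈ U s}
        = (fun ω (s : Fin (L + q)) => z s ω) ⁻¹' S := by
      ext ω
      simp only [S, mem_ofPred_eq, mem_preimage, mem_univ_pi]
      refine ⟨fun h s => ?_, fun h s h1 h2 => by simpa [h1] using h ⟨s, h2⟩⟩
      split_ifs with h1
      exacts [h s h1 s.2, mem_univ _]
    have hpre' : {ω | ∀ s, L ≤ s → s < L + (q + 1) → z s ω ∈ U s}
        = (fun ω => (fun s : Fin (L + q) => z s ω, z (L + q) ω)) ⁻¹' (S ×ˢ U (L + q)) := by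
      ext ω
      have h1 := Set.ext_iff.1 hpre ω
      simp only [mem_ofPred_eq, mem_preimage] at h1
      simp only [mem_ofPred_eq, mem_preimage, mem_prod, ← h1]
      refine ⟨fun h => ⟨fun s h1 h2 => h s h1 (by omega), h _ (by omega) (by omega)⟩,
        fun h s h1 h2 => ?_⟩
      by_cases hs : s < L + q
      · exact h.1 s h1 hs
      · obtain rfl : s = L + q := by omega
        exact h.2
    rw [hpre, ← Measure.map_apply hX hS] at ih
    rw [hpre', ← Measure.map_apply (hX.prodMk (hm _)) (hS.prod (hU _).measurableSet), hlaw,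
      Measure.compProd_apply_prod hS (hU _).measurableSet]
    intro h0
    rw [lintegral_eq_zero_iff (Kernel.measurable_coe _ (hU _).measurableSet),
      EventuallyEq, ae_restrict_iff' hS] at h0
    refine ih (measure_mono_null (fun y hy => ?_) (ae_iff.1 h0))
    intro hy0
    have h1 := hy0 hy
    rw [Kernel.map_id, Kernel.comap_apply] at h1
    have h2 := hν.ae_of_ae_shiftedLaw (p := fun x => x ∉ U (L + q))
      (measure_eq_zero_iff_ae_notMem.1 h1)
    exact (hU _).measure_ne_zero volume (hne _) (measure_eq_zero_iff_ae_notMem.2 h2)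

/-- Once the `L` vectors it depends on are driven by noises, the drift charges every open set. -/
theorem measure_drift_mem_ne_zero (hz : IsGenLaplaceVAR P B α lam z ε)
    (hB : ∃ τ, (B τ).rank = n) {t : ℕ} (ht : 2 * L ≤ t) {V : Set (Fin n → ℝ)} (hV : IsOpen V)
    (hne : V.Nonempty) : P {ω | drift B (fun τ => z (t - (τ + 1)) ω) ∈ V} ≠ 0 := by
  obtain ⟨v, hv⟩ := hne
  obtain ⟨w, hw⟩ := surjective_drift hB v
  obtain ⟨u, hu, hsub⟩ := isOpen_pi_iff'.1 (hV.preimage (continuous_drift B)) w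
    (by rw [mem_preimage, hw]; exact hv)
  have hpos := hz.measure_forall_mem_ne_zero
    (U := fun s => if h : t - s - 1 < L then u ⟨t - s - 1, h⟩ else univ)
    (fun s => by split_ifs; exacts [(hu _).1, isOpen_univ])
    (fun s => by split_ifs; exacts [⟨_, (hu _).2⟩, univ_nonempty]) t
  refine fun h0 => hpos (measure_mono_null (fun ω hω => hsub ?_) h0)
  intro τ _
  have h1 := hω (t - (τ + 1)) (by omega) (by omega)
  have h2 : t - (t - ((τ : ℕ) + 1)) - 1 = τ := by omega
  simpa [h2] using h1

end IsGenLaplaceVAR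

/-- Observationally equivalent models have the same conditional law of an observation given its
past, so their noise laws match at the predictions made from the respective latent pasts. -/
theorem dense_matches_of_observationallyEquivalent {n m L L' : ℕ}
    {Ω : Type*} [MeasurableSpace Ω] {P : Measure Ω} [IsProbabilityMeasure P]
    {B : Fin L → Matrix (Fin n) (Fin n) ℝ} {α lam : Fin n → ℝ}
    {z ε : ℕ → Ω → Fin n → ℝ} (hz : IsGenLaplaceVAR P B α lam z ε) (hB : ∃ τ, (B τ).rank = n)
    {g : (Fin n → ℝ) → (Fin m → ℝ)} (hg : MeasurableEmbedding g)
    {Ω' : Type*} [MeasurableSpace Ω'] {P' : Measure Ω'} [IsProbabilityMeasure P']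
    {B' : Fin L' → Matrix (Fin n) (Fin n) ℝ} {α' lam' : Fin n → ℝ}
    {z' ε' : ℕ → Ω' → Fin n → ℝ} (hz' : IsGenLaplaceVAR P' B' α' lam' z' ε')
    {g' : (Fin n → ℝ) → (Fin m → ℝ)} (hg' : MeasurableEmbedding g')
    (hobs : ObservationallyEquivalent P g z P' g' z') :
    Dense {a | ∃ b, Matches (noiseLaw α lam) (noiseLaw α' lam') g g' a b} := by
  have := hz.hasPotential.isProbabilityMeasure
  have := hz'.hasPotential.isProbabilityMeasure
  obtain ⟨r, hr, hrg⟩ := hg.exists_measurable_extend measurable_id fun _ => inferInstance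
  obtain ⟨r', hr', hrg'⟩ := hg'.exists_measurable_extend measurable_id fun _ => inferInstance
  have hrg : ∀ x, r (g x) = x := congrFun hrg
  have hrg' : ∀ x, r' (g' x) = x := congrFun hrg'
  -- Both lags are over, and the `L` latent vectors before `t` are driven by noises.
  obtain ⟨t, ht, ht'⟩ : ∃ t, 2 * L ≤ t ∧ L' ≤ t := ⟨max (2 * L) L', by simp, by simp⟩
  set c : (Fin t → Fin m → ℝ) → Fin n → ℝ := fun y =>
    drift B fun τ => r (y ⟨t - (τ + 1), by omega⟩)
  set c' : (Fin t → Fin m → ℝ) → Fin n → ℝ := fun y =>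
    drift B' fun τ => r' (y ⟨t - (τ + 1), by omega⟩)
  have hc : Measurable c := (continuous_drift B).measurable.comp (by fun_prop)
  have hc' : Measurable c' := (continuous_drift B').measurable.comp (by fun_prop)
  have hlaw := hz.map_past_next (by omega) hg.measurable hrg hc fun _ => rfl
  have hlaw' := hz'.map_past_next ht' hg'.measurable hrg' hc' fun _ => rfl
  have hm : ∀ s, Measurable fun ω => g (z s ω) := fun s =>
    hg.measurable.comp (hz.measurable_latent s)
  have hm' : ∀ s, Measurable fun ω => g' (z' s ω) := fun s =>
    hg'.measurable.comp (hz'.measurable_latent s)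
  have htrans : ∀ {X : Type} [MeasurableSpace X] {φ : (ℕ → Fin m → ℝ) → X}, Measurable φ →
      P'.map (fun ω => φ fun s => g' (z' s ω)) = P.map fun ω => φ fun s => g (z s ω) := by
    intro X _ φ hφ
    have := congrArg (Measure.map φ) hobs
    rwa [Measure.map_map hφ (measurable_pi_lambda _ hm'),
      Measure.map_map hφ (measurable_pi_lambda _ hm)] at this
  have hpast := htrans (φ := fun x (s : Fin t) => x s) (by fun_prop)
  have hboth := htrans (φ := fun x => (fun s : Fin t => x s, x t)) (by fun_prop)
  have hX : AEMeasurable (fun ω (s : Fin t) => g (z s ω)) P :=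
    (measurable_pi_lambda _ fun s : Fin t => hm s).aemeasurable
  have := Measure.isProbabilityMeasure_map hX
  have := Kernel.IsMarkovKernel.map ((shiftedKernel (noiseLaw α lam)).comap c hc) hg.measurable
  have := Kernel.IsMarkovKernel.map ((shiftedKernel (noiseLaw α' lam')).comap c' hc')
    hg'.measurable
  rw [hlaw, hlaw', hpast] at hboth
  have hae := ae_of_ae_map hX (Kernel.ae_eq_of_compProd_eq hboth)
  refine dense_iff_inter_open.2 fun V hV hne => ?_
  by_contra hcon
  refine hz.measure_drift_mem_ne_zero hB ht hV hne (measure_mono_null (fun ω hω => ?_)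
    (ae_iff.1 hae))
  intro heq
  refine hcon ⟨_, hω, c' fun s => g (z s ω), ?_⟩
  rw [Kernel.map_apply _ hg.measurable, Kernel.map_apply _ hg'.measurable, Kernel.comap_apply,
    Kernel.comap_apply] at heq
  have hcω : c (fun s => g (z s ω)) = drift B fun τ => z (t - (τ + 1)) ω := by
    simp only [c, hrg]
  rw [hcω] at heq
  exact heq.symm

theorem theorem2 {n m L : ℕ}
    -- the true model: its process and its mixing function
    {Ω : Type*} [MeasurableSpace Ω] (P : Measure Ω) [IsProbabilityMeasure P]
    (B : Fin L → Matrix (Fin n) (Fin n) ℝ) (α lam : Fin n → ℝ)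
    (z ε : ℕ → Ω → Fin n → ℝ) (hz : IsGenLaplaceVAR P B α lam z ε)
    (hB : ∃ τ, (B τ).rank = n)
    (g : (Fin n → ℝ) → (Fin m → ℝ)) (hg : IsMixing g)
    -- any learned model, with its own parameters
    {L' : ℕ} {Ω' : Type*} [MeasurableSpace Ω'] (P' : Measure Ω') [IsProbabilityMeasure P']
    (B' : Fin L' → Matrix (Fin n) (Fin n) ℝ) (α' lam' : Fin n → ℝ)
    (z' ε' : ℕ → Ω' → Fin n → ℝ) (hz' : IsGenLaplaceVAR P' B' α' lam' z' ε')
    (g' : (Fin n → ℝ) → (Fin m → ℝ)) (hg' : IsMixing g')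
    (hobs : ObservationallyEquivalent P g z P' g' z') :
    EqUpToPermComponentwise g g' := by
  have hge := hg.measurable.measurableEmbedding hg.injective
  have hge' := hg'.measurable.measurableEmbedding hg'.injective
  exact eqUpToPermComponentwise_of_dense_matches hz.hasPotential hz'.hasPotential hz'.shape_pos
    hz'.shape_lt_two hz'.lam_pos hge hge'
    (dense_matches_of_observationallyEquivalent hz hB hge hz' hge' hobs)
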